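/- An $L$-algebra is a set $X$ with a binary operation $(x,y)\mapsto x\cdot y$ and an element $1\in X$ such that, for all $x,y,z\in X$: $x\cdot x=x\cdot 1=1$, $1\cdot x=x$, $(x\cdot y)\cdot(x\cdot z)=(y\cdot x)\cdot(y\cdot z)$, and $x\cdot y=y\cdot x=1$ implies $x=y$. It is partially ordered by $x\le y:\Leftrightarrow x\cdot y=1$. An ideal of $X$ is a subset $I$ with $1\in I$ such that, for all $x,y\in X$: if $x\in I$ and $x\cdot y\in I$, then $y\in I$; and if $x\in I$, then $(x\cdot y)\cdot y$, $y\cdot x$ and $y\cdot(x\cdot y)$ belong to $I$. The set $\mathscr{I}(X)$ of ideals, ordered by inclusion, is a complete lattice whose meets are intersections; $\langle x\rangle$ denotes the ideal generated by $x$, that is, the smallest ideal containing $x$. A locale is a complete lattice $A$ with $a\wedge\bigvee_i b_i=\bigvee_i(a\wedge b_i)$ for all families; it is an $L$-algebra with unit the greatest element and with the operation $a\cdot b=\bigvee\{c\in A\mid c\wedge a\le b\}$. An element $p<1$ of an $L$-algebra is prime if every element $x$ satisfies $x\le p$ or $x\cdot p\le p$; an $L$-algebra (in particular, a locale) is spatial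 if each of its elements $x$ is the meet of the prime elements $p$ with $x\le p$. **Corollary.** For every $L$-algebra $X$, the lattice $\mathscr{I}(X)$ of ideals is a spatial locale. Its $L$-algebra operation is given, for ideals $I$ and $J$ of $X$, by $$I\cdot J=\{x\in X\mid \langle x\rangle\cap I\subseteq J\},$$ and $I\cdot J$ is the greatest ideal $K$ of $X$ with $K\cap I\subseteq J$. -/

import Mathlib

/-- An `L`-algebra: a set with a binary operation, written `x ⇀ y`, and a logical unit `1`. -/
class LAlgebra (X : Type*) extends One X where
  /-- The operation `(x, y) ↦ x · y`. -/
  op : X → X → X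
  op_self : ∀ x : X, op x x = 1
  op_one : ∀ x : X, op x 1 = 1
  one_op : ∀ x : X, op 1 x = x
  op_op_op : ∀ x y z : X, op (op x y) (op x z) = op (op y x) (op y z)
  eq_of_op_eq_one : ∀ x y : X, op x y = 1 → op y x = 1 → x = y

infixr:67 " ⇀ " => LAlgebra.op

namespace LAlgebra

/-- The natural partial order of an `L`-algebra: `x ≤ y` means `x ⇀ y = 1`. It is not an instance,
so that it does not compete with an order that the type already carries. -/
abbrev toPartialOrder (X : Type*) [LAlgebra X] : PartialOrder X where
  le x y := x ⇀ y = 1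
  le_refl x := op_self x
  le_trans x y z hxy hyz := by
    have h := op_op_op x y z
    rw [hxy, hyz, one_op, op_one] at h
    exact h
  le_antisymm x y hxy hyx := eq_of_op_eq_one x y hxy hyx

/-- An element `p` of an `L`-algebra is prime if `p < 1` and every `x` satisfies `x ≤ p` or
`x ⇀ p ≤ p`, in the natural order. -/
def IsPrimeElement {X : Type*} [LAlgebra X] (p : X) : Prop :=
  letI := toPartialOrder X
  p < 1 ∧ ∀ x : X, x ≤ p ∨ x ⇀ p ≤ p

/-- An `L`-algebra is spatial if every element is the meet, in the natural order, of the prime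
elements above it. -/
def IsSpatial (X : Type*) [LAlgebra X] : Prop :=
  letI := toPartialOrder X
  ∀ x : X, IsGLB {p : X | IsPrimeElement p ∧ x ≤ p} x

/-- A locale (frame) as an `L`-algebra: the unit is `⊤` and the operation is the Heyting implication
`a ⇨ b`, that is, the join of all `c` with `c ⊓ a ≤ b`. -/
abbrev ofFrame (A : Type*) [Order.Frame A] : LAlgebra A where
  one := ⊤
  op a b := a ⇨ b
  op_self _ := himp_self
  op_one _ := himp_top
  one_op _ := top_himp
  op_op_op x y z := by
    rw [himp_himp, himp_himp, himp_inf_self, himp_inf_self, inf_comm]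
  eq_of_op_eq_one _ _ hxy hyx := le_antisymm (himp_eq_top_iff.1 hxy) (himp_eq_top_iff.1 hyx)

end LAlgebra

/-- An ideal of an `L`-algebra. -/
structure LIdeal (X : Type*) [LAlgebra X] where
  carrier : Set X
  one_mem' : (1 : X) ∈ carrier
  mem_of_op_mem' : ∀ x y : X, x ∈ carrier → x ⇀ y ∈ carrier → y ∈ carrier
  op_op_mem' : ∀ x y : X, x ∈ carrier → (x ⇀ y) ⇀ y ∈ carrier
  op_mem' : ∀ x y : X, x ∈ carrier → y ⇀ x ∈ carrier
  op_op_mem'' : ∀ x y : X, x ∈ carrier → y ⇀ (x ⇀ y) ∈ carrier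

namespace LIdeal

variable {X : Type*} [LAlgebra X]

instance : SetLike (LIdeal X) X where
  coe := LIdeal.carrier
  coe_injective I J h := by
    cases I
    cases J
    congr

/-- Ideals are ordered by inclusion. -/
instance : PartialOrder (LIdeal X) := PartialOrder.ofSetLike (LIdeal X) X

/-- The intersection of a set of ideals. -/
instance : InfSet (LIdeal X) where
  sInf S :=
    { carrier := ⋂ I ∈ S, (I : Set X)
      one_mem' := Set.mem_iInter₂.2 fun I _ => I.one_mem'
      mem_of_op_mem' := fun x y hx hxy => Set.mem_iInter₂.2 fun I hI =>
        I.mem_of_op_mem' x y (Set.mem_iInter₂.1 hx I hI) (Set.mem_iInter₂.1 hxy I hI)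
      op_op_mem' := fun x y hx => Set.mem_iInter₂.2 fun I hI =>
        I.op_op_mem' x y (Set.mem_iInter₂.1 hx I hI)
      op_mem' := fun x y hx => Set.mem_iInter₂.2 fun I hI =>
        I.op_mem' x y (Set.mem_iInter₂.1 hx I hI)
      op_op_mem'' := fun x y hx => Set.mem_iInter₂.2 fun I hI =>
        I.op_op_mem'' x y (Set.mem_iInter₂.1 hx I hI) }

theorem isGLB_sInf (S : Set (LIdeal X)) : IsGLB S (sInf S) :=
  ⟨fun I hI _ hx => Set.mem_iInter₂.1 hx I hI,
    fun _ hK _ hx => Set.mem_iInter₂.2 fun _ hI => hK hI hx⟩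

/-- The complete lattice of ideals, ordered by inclusion, with intersections as meets. -/
instance instCompleteLattice : CompleteLattice (LIdeal X) :=
  completeLatticeOfInf (LIdeal X) isGLB_sInf

/-- The ideal `⟨x⟩` generated by `x`: the smallest ideal that contains `x`. -/
def generatedBy (x : X) : LIdeal X := sInf {I : LIdeal X | x ∈ I}

end LIdeal

/-!
An ideal `I` of an `L`-algebra yields a congruence `x ~ y ↔ x ⇀ y, y ⇀ x ∈ I`, and conversely the
class of `1` under any equivalence relation compatible with `⇀` is an ideal
(`LIdeal.ofCongruence`). Hence the join of a family of ideals lies in the class of `1` under the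
equivalence relation generated by their congruences.

Distributivity follows by letting elements act on an ideal `I` by `c ↦ c ⇀ a` with `a ∈ I`. If `c`
and `d` are congruent modulo `J`, then `c ⇀ a` and `d ⇀ a` are congruent modulo `I ⊓ J`. So if a
chain of such steps, for various `J`, joins `1` to `a`, then `1 ⇀ a = a` and `a ⇀ a = 1` are
congruent modulo the join of the `I ⊓ J`, which therefore contains `a`
(`LIdeal.inf_sSup_le_iSup_inf`).

Since unions of chains of ideals are ideals, Zorn's lemma gives, for `x ∉ I`, an ideal `P ≥ I`
maximal among those avoiding `x`; distributivity makes `P` prime, and spatiality follows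
(`LIdeal.exists_prime_of_notMem`).
-/

open LAlgebra

namespace LIdeal

variable {X : Type*} [LAlgebra X]

/-- Congruence modulo an ideal `I`: both `x ⇀ y` and `y ⇀ x` belong to `I`. -/
def Rel (I : LIdeal X) (x y : X) : Prop := x ⇀ y ∈ I ∧ y ⇀ x ∈ I

theorem Rel.symm {I : LIdeal X} {x y : X} (h : I.Rel x y) : I.Rel y x := ⟨h.2, h.1⟩

theorem op_mem_trans {I : LIdeal X} {x y z : X} (hxy : x ⇀ y ∈ I) (hyz : y ⇀ z ∈ I) :
    x ⇀ z ∈ I := by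
  refine I.mem_of_op_mem' (x ⇀ y) _ hxy ?_
  rw [op_op_op]
  exact I.op_mem' _ _ hyz

theorem Rel.trans {I : LIdeal X} {x y z : X} (hxy : I.Rel x y) (hyz : I.Rel y z) : I.Rel x z :=
  ⟨op_mem_trans hxy.1 hyz.1, op_mem_trans hyz.2 hxy.2⟩

theorem rel_equivalence (I : LIdeal X) : Equivalence I.Rel :=
  ⟨fun x => by rw [Rel, op_self]; exact ⟨I.one_mem', I.one_mem'⟩, Rel.symm, Rel.trans⟩

theorem Rel.mono {I J : LIdeal X} (hIJ : I ≤ J) {x y : X} (h : I.Rel x y) : J.Rel x y :=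
  ⟨hIJ h.1, hIJ h.2⟩

theorem Rel.op_left {I : LIdeal X} {x y : X} (h : I.Rel x y) (z : X) :
    I.Rel (z ⇀ x) (z ⇀ y) := by
  refine ⟨?_, ?_⟩ <;> rw [op_op_op]
  exacts [I.op_mem' _ _ h.1, I.op_mem' _ _ h.2]

theorem rel_op_of_mem {I : LIdeal X} {x : X} (hx : x ∈ I) (y : X) : I.Rel y (x ⇀ y) :=
  ⟨I.op_op_mem'' x y hx, I.op_op_mem' x y hx⟩

/-- Modulo `I`, the two sides of `(x ⇀ y) ⇀ (x ⇀ z) = (y ⇀ x) ⇀ (y ⇀ z)` are `x ⇀ z` and `y ⇀ z`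
if `x` and `y` are congruent. -/
theorem Rel.op_right {I : LIdeal X} {x y : X} (h : I.Rel x y) (z : X) :
    I.Rel (x ⇀ z) (y ⇀ z) := by
  have hx := rel_op_of_mem h.1 (x ⇀ z)
  rw [op_op_op] at hx
  exact hx.trans (rel_op_of_mem h.2 (y ⇀ z)).symm

theorem rel_one_iff {I : LIdeal X} {x : X} : I.Rel 1 x ↔ x ∈ I := by
  rw [Rel, one_op, op_one]
  exact and_iff_left I.one_mem'

/-- The class of `1` under an equivalence relation compatible with `⇀`. The quotient need not
satisfy the antisymmetry axiom of an `L`-algebra. -/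
def ofCongruence (r : X → X → Prop) (hr : Equivalence r)
    (hl : ∀ x y z, r x y → r (z ⇀ x) (z ⇀ y)) (hrt : ∀ x y z, r x y → r (x ⇀ z) (y ⇀ z)) :
    LIdeal X where
  carrier := {x | r 1 x}
  one_mem' := hr.refl 1
  mem_of_op_mem' x y hx hxy := by
    have h := hrt _ _ y hx
    rw [one_op] at h
    exact hr.trans hxy (hr.symm h)
  op_op_mem' x y hx := by
    have h := hrt _ _ y (hrt _ _ y hx)
    rwa [one_op, op_self] at h
  op_mem' x y hx := by
    have h := hl _ _ y hx
    rwa [op_one] at h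
  op_op_mem'' x y hx := by
    have h := hl _ _ y (hrt _ _ y hx)
    rwa [one_op, op_self] at h

theorem mem_inf {I J : LIdeal X} {x : X} : x ∈ I ⊓ J ↔ x ∈ I ∧ x ∈ J := by
  refine ⟨fun h => ⟨(inf_le_left : I ⊓ J ≤ I) h, (inf_le_right : I ⊓ J ≤ J) h⟩, fun h => ?_⟩
  refine Set.mem_iInter₂.2 fun K hK => ?_
  rcases hK with rfl | rfl
  exacts [h.1, h.2]

theorem inf_le_iff {I J K : LIdeal X} : K ⊓ I ≤ J ↔ (K : Set X) ∩ (I : Set X) ⊆ (J : Set X) :=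
  ⟨fun h _ hx => h (mem_inf.2 hx), fun h _ hx => h (mem_inf.1 hx)⟩

/-- Congruence modulo `J` of elements of `I` is congruence modulo `I ⊓ J`; applied to the values
`c ⇀ a` and `d ⇀ a`, which lie in `I` with `a`. -/
theorem Rel.op_right_inf {I J : LIdeal X} {c d a : X} (h : J.Rel c d) (ha : a ∈ I) :
    (I ⊓ J).Rel (c ⇀ a) (d ⇀ a) :=
  ⟨mem_inf.2 ⟨I.op_mem' _ _ (I.op_mem' _ _ ha), (h.op_right a).1⟩,
    mem_inf.2 ⟨I.op_mem' _ _ (I.op_mem' _ _ ha), (h.op_right a).2⟩⟩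

/-- The relation of being congruent modulo some member of a set of ideals. -/
def RelSome (S : Set (LIdeal X)) (x y : X) : Prop := ∃ J ∈ S, J.Rel x y

theorem eqvGen_relSome_map {S : Set (LIdeal X)} (f : X → X)
    (hf : ∀ (J : LIdeal X) (x y : X), J.Rel x y → J.Rel (f x) (f y)) {x y : X}
    (h : Relation.EqvGen (RelSome S) x y) : Relation.EqvGen (RelSome S) (f x) (f y) := by
  induction h with
  | rel x y h => exact .rel _ _ (h.imp fun J hJ => ⟨hJ.1, hf J x y hJ.2⟩)
  | refl x => exact .refl _
  | symm x y _ ih => exact .symm _ _ ih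
  | trans x y z _ _ ih₁ ih₂ => exact .trans _ _ _ ih₁ ih₂

theorem eqvGen_relSome_one_of_mem_sSup {S : Set (LIdeal X)} {x : X} (hx : x ∈ sSup S) :
    Relation.EqvGen (RelSome S) 1 x := by
  let T : LIdeal X := ofCongruence (Relation.EqvGen (RelSome S)) (Relation.EqvGen.is_equivalence _)
    (fun _ _ z h => eqvGen_relSome_map (z ⇀ ·) (fun _ _ _ h => h.op_left z) h)
    (fun _ _ z h => eqvGen_relSome_map (· ⇀ z) (fun _ _ _ h => h.op_right z) h)
  have hT : sSup S ≤ T := sSup_le fun J hJ y hy => .rel _ _ ⟨J, hJ, rel_one_iff.2 hy⟩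
  exact hT hx

theorem inf_sSup_le_iSup_inf (I : LIdeal X) (S : Set (LIdeal X)) :
    I ⊓ sSup S ≤ ⨆ J ∈ S, I ⊓ J := by
  intro a ha
  obtain ⟨haI, haS⟩ := mem_inf.1 ha
  have key : ∀ c d : X, Relation.EqvGen (RelSome S) c d →
      (⨆ J ∈ S, I ⊓ J).Rel (c ⇀ a) (d ⇀ a) := by
    intro c d h
    induction h with
    | rel c d h =>
      obtain ⟨J, hJ, h⟩ := h
      exact (h.op_right_inf haI).mono (le_iSup₂ (f := fun J (_ : J ∈ S) => I ⊓ J) J hJ)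
    | refl c => exact (rel_equivalence _).refl _
    | symm c d _ ih => exact ih.symm
    | trans c d e _ _ ih₁ ih₂ => exact ih₁.trans ih₂
  have h := key 1 a (eqvGen_relSome_one_of_mem_sSup haS)
  rw [one_op, op_self] at h
  exact rel_one_iff.1 h.symm

/-- The frame of ideals; its complete lattice is definitionally the given one. -/
abbrev frame (X : Type*) [LAlgebra X] : Order.Frame (LIdeal X) :=
  Order.Frame.ofMinimalAxioms ⟨inf_sSup_le_iSup_inf⟩

theorem generatedBy_le_iff {x : X} {I : LIdeal X} : generatedBy x ≤ I ↔ x ∈ I :=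
  ⟨fun h => h (Set.mem_iInter₂.2 fun _ hJ => hJ), fun h => (isGLB_sInf _).1 h⟩

/-- The union of a nonempty chain of ideals. -/
def chainUnion (C : Set (LIdeal X)) (hC : IsChain (· ≤ ·) C) (hne : C.Nonempty) : LIdeal X where
  carrier := {x | ∃ I ∈ C, x ∈ I}
  one_mem' := hne.imp fun I hI => ⟨hI, I.one_mem'⟩
  mem_of_op_mem' := by
    rintro x y ⟨I, hI, hx⟩ ⟨J, hJ, hxy⟩
    rcases hC.total hI hJ with h | h
    · exact ⟨J, hJ, J.mem_of_op_mem' x y (h hx) hxy⟩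
    · exact ⟨I, hI, I.mem_of_op_mem' x y hx (h hxy)⟩
  op_op_mem' := fun x y ⟨I, hI, hx⟩ => ⟨I, hI, I.op_op_mem' x y hx⟩
  op_mem' := fun x y ⟨I, hI, hx⟩ => ⟨I, hI, I.op_mem' x y hx⟩
  op_op_mem'' := fun x y ⟨I, hI, hx⟩ => ⟨I, hI, I.op_op_mem'' x y hx⟩

theorem exists_maximal_notMem {I : LIdeal X} {x : X} (hx : x ∉ I) :
    ∃ P, I ≤ P ∧ Maximal (fun K : LIdeal X => x ∉ K) P := by
  refine zorn_le_nonempty₀ {K : LIdeal X | x ∉ K} (fun C hCx hC K hK => ?_) I hx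
  exact ⟨chainUnion C hC ⟨K, hK⟩, fun ⟨J, hJ, hxJ⟩ => hCx hJ hxJ, fun J hJ y hy => ⟨J, hJ, hy⟩⟩

theorem exists_prime_of_notMem {I : LIdeal X} {x : X} (hx : x ∉ I) :
    ∃ P : LIdeal X, I ≤ P ∧ x ∉ P ∧
      @IsPrimeElement (LIdeal X) (@ofFrame (LIdeal X) (frame X)) P := by
  let _ := frame X
  obtain ⟨P, hIP, hP⟩ := exists_maximal_notMem hx
  -- An ideal not contained in `P` has a join with `P` that contains `x`.
  have hmem : ∀ K : LIdeal X, ¬ K ≤ P → x ∈ P ⊔ K := fun K hK => by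
    by_contra h
    exact hK (le_sup_right.trans (hP.2 h le_sup_left))
  have hprime : ∀ K : LIdeal X, K ≤ P ∨ K ⇨ P ≤ P := fun K => by
    by_contra! h
    have hx' : x ∈ (P ⊔ K) ⊓ (P ⊔ (K ⇨ P)) := mem_inf.2 ⟨hmem _ h.1, hmem _ h.2⟩
    rw [← sup_inf_left] at hx'
    have hle : P ⊔ K ⊓ (K ⇨ P) ≤ P := sup_le le_rfl inf_himp_le
    exact hP.1 (hle hx')
  refine ⟨P, hIP, hP.1, ⟨himp_eq_top_iff.2 le_top, fun h => ?_⟩, fun K => ?_⟩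
  · have hle : (⊤ : LIdeal X) ≤ P := himp_eq_top_iff.1 h
    exact hP.1 (generatedBy_le_iff.1 (le_top.trans hle))
  · exact (hprime K).imp himp_eq_top_iff.2 himp_eq_top_iff.2

theorem isSpatial (X : Type*) [LAlgebra X] :
    @IsSpatial (LIdeal X) (@ofFrame (LIdeal X) (frame X)) := by
  let _ := frame X
  intro I
  refine ⟨fun P hP => hP.2, fun K hK => himp_eq_top_iff.2 (show K ≤ I from fun x hx => ?_)⟩
  by_contra hxI
  obtain ⟨P, hIP, hxP, hP⟩ := exists_prime_of_notMem hxI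
  exact hxP (himp_eq_top_iff.1 (hK ⟨hP, himp_eq_top_iff.2 hIP⟩) hx)

end LIdeal

theorem corollary5 (X : Type*) [LAlgebra X] :
    ∃ F : Order.Frame (LIdeal X),
      F.toCompleteLattice = LIdeal.instCompleteLattice ∧
      @LAlgebra.IsSpatial (LIdeal X) (@LAlgebra.ofFrame (LIdeal X) F) ∧
      (∀ I J : LIdeal X,
        (((@LAlgebra.ofFrame (LIdeal X) F).op I J : LIdeal X) : Set X) =
          {x : X | (LIdeal.generatedBy x : Set X) ∩ (I : Set X) ⊆ (J : Set X)}) ∧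
      (∀ I J : LIdeal X,
        IsGreatest {K : LIdeal X | (K : Set X) ∩ (I : Set X) ⊆ (J : Set X)}
          ((@LAlgebra.ofFrame (LIdeal X) F).op I J)) := by
  let _ := LIdeal.frame X
  refine ⟨LIdeal.frame X, rfl, LIdeal.isSpatial X, fun I J => ?_, fun I J => ⟨?_, fun K hK => ?_⟩⟩
  · ext x
    exact LIdeal.generatedBy_le_iff.symm.trans (le_himp_iff.trans LIdeal.inf_le_iff)
  · exact LIdeal.inf_le_iff.1 himp_inf_le
  · exact le_himp_iff.2 (LIdeal.inf_le_iff.2 hK)
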